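/- For a real $m\times n$ matrix $M$ with singular values $\sigma_1(M)\ge\dots\ge\sigma_r(M)\ge 0$, $r=\min\{m,n\}$, and an integer $p\ge 1$, let $\|M\|_p=\bigl(\sum_{j=1}^r\sigma_j(M)^p\bigr)^{1/p}$ be the Schatten $p$-norm, and let $M^\dagger$ be the Moore–Penrose inverse. If $M=U\Sigma V^T$ is a full singular value decomposition ($U,V$ orthogonal, $\Sigma$ rectangular diagonal with diagonal $\sigma_1(M),\dots,\sigma_r(M)$), then the best rank-$k$ approximation of $M$ obtained from it is $M_k=U\Sigma_{(k)}V^T$, where $\Sigma_{(k)}$ arises from $\Sigma$ by replacing every $\sigma_j(M)$ with $j>k$ by $0$. Theorem. Let $p\ge 1$ be an even integer, $A\in\mathbb{R}^{m\times n}$ and $\tilde A\in\mathbb{R}^{m\times c}$. 1. For every orthogonal projector $P\in\mathbb{R}^{m\times m}$ ($P^2=P=P^T$), with $s=\operatorname{rank}(P)$ (in particular if $s=c$), $$\Bigl|\,\|(I-P)A\|_p^2-\|(I-P)\tilde A\|_p^2\Bigr|\le\min\Bigl\{\|AA^T-\tilde A\tilde A^T\|_{p/2},\ (m-s)^{1/p}\,\|AA^T-\tilde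 A\tilde A^T\|_p\Bigr\}.$$ 2. If $\operatorname{rank}(\tilde A)=c$, then $$\|(I-\tilde A\tilde A^\dagger)A\|_p^2\le\min\Bigl\{\|AA^T-\tilde A\tilde A^T\|_{p/2},\ (m-c)^{1/p}\,\|AA^T-\tilde A\tilde A^T\|_p\Bigr\}.$$ 3. If $A_k$ is a best rank-$k$ approximation of $A$ and $\tilde A_k\in\mathbb{R}^{m\times c}$ is a best rank-$k$ approximation of $\tilde A$ with $\operatorname{rank}(\tilde A_k)=k$, then $$\|(I-\tilde A_k\tilde A_k^\dagger)A\|_p^2\le\|A-A_k\|_p^2+2\min\Bigl\{\|AA^T-\tilde A\tilde A^T\|_{p/2},\ (m-k)^{1/p}\,\|AA^T-\tilde A\tilde A^T\|_p\Bigr\}.$$ -/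

import Mathlib

/-- The singular value `σ_{i+1}(A)` of a real matrix (zero-indexed, in descending order): a singular
value of the map `x ↦ A x` between Euclidean spaces. It is `0` for `min m n ≤ i`. -/
noncomputable def matSingularValue {m n : ℕ} (A : Matrix (Fin m) (Fin n) ℝ) (i : ℕ) : ℝ :=
  (Matrix.toEuclideanLin A).singularValues i

/-- The Schatten `p`-norm `(∑_{j ≤ min(m,n)} σ_j(A)^p)^{1/p}`, for an integer `p ≥ 1`. -/
noncomputable def schattenNorm {m n : ℕ} (p : ℕ) (A : Matrix (Fin m) (Fin n) ℝ) : ℝ :=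
  (∑ i ∈ Finset.range (min m n), matSingularValue A i ^ p) ^ (1 / (p : ℝ))

/-- The rectangular `m × n` matrix with diagonal `s 0, s 1, …`. -/
def rectDiag (m n : ℕ) (s : ℕ → ℝ) : Matrix (Fin m) (Fin n) ℝ :=
  Matrix.of fun i j => if (i : ℕ) = (j : ℕ) then s i else 0

/-- `B` is a best rank-`k` approximation `U_k Σ_k V_kᵀ` of `A`: it arises from some full singular
value decomposition `A = U Σ Vᵀ` by keeping the `k` dominant singular values (and the leading `k`
columns of `U` and `V`) and replacing the other singular values by zero. -/
def IsBestRankApprox {m n : ℕ} (k : ℕ) (A B : Matrix (Fin m) (Fin n) ℝ) : Prop :=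
  ∃ (U : Matrix (Fin m) (Fin m) ℝ) (V : Matrix (Fin n) (Fin n) ℝ),
    U ∈ Matrix.orthogonalGroup (Fin m) ℝ ∧ V ∈ Matrix.orthogonalGroup (Fin n) ℝ ∧
    A = U * rectDiag m n (matSingularValue A) * V.transpose ∧
    B = U * rectDiag m n (fun i => if i < k then matSingularValue A i else 0) * V.transpose

/-- The four Penrose equations: `X` is the Moore–Penrose inverse of the real matrix `A`. -/
structure IsMoorePenrose {m n : ℕ} (A : Matrix (Fin m) (Fin n) ℝ)
    (X : Matrix (Fin n) (Fin m) ℝ) : Prop where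
  mul_mul_self : A * X * A = A
  self_mul_mul : X * A * X = X
  left_symm : (A * X).transpose = A * X
  right_symm : (X * A).transpose = X * A

theorem exists_isMoorePenrose {m n : ℕ} (A : Matrix (Fin m) (Fin n) ℝ) :
    ∃ X, IsMoorePenrose A X := by
  have hG : (A.transpose * A).IsHermitian := by
    simpa using Matrix.isHermitian_conjTranspose_mul_self A
  obtain ⟨H, hHs, hGHG, hHGH, hcomm⟩ : ∃ H : Matrix (Fin n) (Fin n) ℝ, H.transpose = H ∧
      (A.transpose * A) * H * (A.transpose * A) = A.transpose * A ∧
      H * (A.transpose * A) * H = H ∧ H * (A.transpose * A) = (A.transpose * A) * H := by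
    set U : Matrix (Fin n) (Fin n) ℝ := (hG.eigenvectorUnitary : Matrix (Fin n) (Fin n) ℝ) with hU
    have hUU : U.transpose * U = 1 := by
      have h := Matrix.mem_unitaryGroup_iff'.mp hG.eigenvectorUnitary.2
      simpa [Matrix.star_eq_conjTranspose] using h
    set d := hG.eigenvalues
    have hspec : A.transpose * A = U * Matrix.diagonal d * U.transpose := by
      have h := hG.spectral_theorem
      simpa [Unitary.conjStarAlgAut_apply, Matrix.star_eq_conjTranspose, Function.comp_def] using h
    have key : ∀ a b : Fin n → ℝ, (U * Matrix.diagonal a * U.transpose) *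
        (U * Matrix.diagonal b * U.transpose) =
        U * Matrix.diagonal (fun i => a i * b i) * U.transpose := by
      intro a b
      calc _ = U * Matrix.diagonal a * (U.transpose * U) * Matrix.diagonal b * U.transpose := by
            simp only [Matrix.mul_assoc]
        _ = _ := by
            rw [hUU, Matrix.mul_one, Matrix.mul_assoc U, Matrix.diagonal_mul_diagonal]
    refine ⟨U * Matrix.diagonal (fun i => (d i)⁻¹) * U.transpose, ?_, ?_, ?_, ?_⟩
    · simp [Matrix.transpose_mul, Matrix.mul_assoc]
    · rw [hspec, key, key]; simp
    · rw [hspec, key, key]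
      congr 3; funext i
      by_cases h : d i = 0 <;> simp [h]
    · rw [hspec, key, key]; simp only [mul_comm]
  refine ⟨H * A.transpose, ?_, ?_, ?_, ?_⟩
  · have h0 : A * (H * (A.transpose * A) - 1) = 0 := by
      rw [← Matrix.conjTranspose_mul_self_eq_zero]
      simp only [Matrix.conjTranspose_eq_transpose_of_trivial]
      rw [Matrix.transpose_mul, Matrix.mul_assoc, ← Matrix.mul_assoc A.transpose, Matrix.mul_sub,
        ← Matrix.mul_assoc (A.transpose * A), hGHG, Matrix.mul_one, sub_self, Matrix.mul_zero]
    rw [Matrix.mul_sub, Matrix.mul_one, sub_eq_zero] at h0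
    simpa only [Matrix.mul_assoc] using h0
  · calc _ = H * (A.transpose * A) * H * A.transpose := by simp only [Matrix.mul_assoc]
      _ = _ := by rw [hHGH]
  · simp [Matrix.transpose_mul, hHs, Matrix.mul_assoc]
  · rw [Matrix.mul_assoc, Matrix.transpose_mul, hHs, Matrix.transpose_mul,
      Matrix.transpose_transpose, hcomm]

/-- The Moore–Penrose inverse `A†`. -/
noncomputable def pinv {m n : ℕ} (A : Matrix (Fin m) (Fin n) ℝ) : Matrix (Fin n) (Fin m) ℝ :=
  (exists_isMoorePenrose A).choose

theorem pinv_spec {m n : ℕ} (A : Matrix (Fin m) (Fin n) ℝ) : IsMoorePenrose A (pinv A) :=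
  (exists_isMoorePenrose A).choose_spec

/-!
Write `p = 2 q`. Since the eigenvalues of `M Mᵀ` are the squared singular values of `M`, the square
of the Schatten `p`-norm of `M` is the Schatten `q`-norm of the symmetric matrix `M Mᵀ`
(`schattenNorm_add_self_sq`). For a projector `P` and `Q = 1 - P`, the first claim therefore compares
the Schatten `q`-norms of `Q A Aᵀ Q` and `Q Ã Ãᵀ Q`; by the triangle inequality they differ by at
most the norm of `Q D Q`, where `D = A Aᵀ - Ã Ãᵀ`. This is at most the `q`-norm of `D`, and, as
`Q D Q` has rank at most `m - rank P`, Cauchy–Schwarz over its nonzero eigenvalues gives the bound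
through the `p`-norm (`abs_schattenNorm_one_sub_mul_sq_sub_le`). Both the triangle inequality and the
contraction under compression rest on one pinching inequality, `sum_abs_diag_conj_pow_le`: the
diagonal of a compressed symmetric matrix in an orthonormal basis is a doubly substochastic image of
the eigenvalues.

The second claim is the case where `P` is the column-space projector `Ã Ã†`, for which `(1 - P) Ã = 0`.

For the third, let `P = Ã_k Ã_k†`, and let `P'` be the projector onto the leading `k` left singular
vectors of `A` in the decomposition defining `A_k`. With `ε` the bound of the first claim for
rank `k`, which applies to both projectors,
`‖(1 - P) A‖² ≤ ‖(1 - P) Ã‖² + ε ≤ ‖Ã - Ã_k‖² + ε ≤ ‖(1 - P') Ã‖² + ε ≤ ‖(1 - P') A‖² + 2 ε`,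
and the last norm is that of `A - A_k`. The third inequality is the optimality of truncation among
projectors of rank at most `k` (`IsBestRankApprox.schattenNorm_sub_sq_le`), which follows from Weyl's
inequality for compressions (`le_eigenvalue_projector_conj`). Using `P'` in this way makes eigenvalue
perturbation inequalities of Lidskii or Mirsky type unnecessary.
-/

section SchattenNorms

open Matrix

variable {m n : ℕ}

/-! ### Orthogonal diagonalisation -/

lemma orthogonal_mul_transpose {U : Matrix (Fin m) (Fin m) ℝ}
    (hU : U ∈ orthogonalGroup (Fin m) ℝ) : U * Uᵀ = 1 := by
  simpa [star_eq_conjTranspose] using mem_unitaryGroup_iff.mp hU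

lemma orthogonal_transpose_mul {U : Matrix (Fin m) (Fin m) ℝ}
    (hU : U ∈ orthogonalGroup (Fin m) ℝ) : Uᵀ * U = 1 := by
  simpa [star_eq_conjTranspose] using mem_unitaryGroup_iff'.mp hU

lemma transpose_conj_diagonal (U : Matrix (Fin m) (Fin m) ℝ) (d : Fin m → ℝ) :
    (U * diagonal d * Uᵀ)ᵀ = U * diagonal d * Uᵀ := by
  simp [transpose_mul, Matrix.mul_assoc]

lemma conj_diagonal_mul_conj_diagonal {U : Matrix (Fin m) (Fin m) ℝ}
    (hU : U ∈ orthogonalGroup (Fin m) ℝ) (a b : Fin m → ℝ) :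
    (U * diagonal a * Uᵀ) * (U * diagonal b * Uᵀ) = U * diagonal (fun i => a i * b i) * Uᵀ := by
  calc _ = U * diagonal a * (Uᵀ * U) * diagonal b * Uᵀ := by simp only [Matrix.mul_assoc]
    _ = _ := by
      rw [orthogonal_transpose_mul hU, Matrix.mul_one, Matrix.mul_assoc U, diagonal_mul_diagonal]

lemma transpose_mul_conj_diagonal_mul {U : Matrix (Fin m) (Fin m) ℝ}
    (hU : U ∈ orthogonalGroup (Fin m) ℝ) (d : Fin m → ℝ) :
    Uᵀ * (U * diagonal d * Uᵀ) * U = diagonal d := by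
  calc _ = (Uᵀ * U) * diagonal d * (Uᵀ * U) := by simp only [Matrix.mul_assoc]
    _ = _ := by simp [orthogonal_transpose_mul hU]

lemma rank_conj_diagonal {U : Matrix (Fin m) (Fin m) ℝ}
    (hU : U ∈ orthogonalGroup (Fin m) ℝ) (d : Fin m → ℝ) :
    (U * diagonal d * Uᵀ).rank = (diagonal d).rank := by
  have h : IsUnit U.det := U.isUnit_det_of_right_inverse (orthogonal_mul_transpose hU)
  rw [rank_mul_eq_left_of_isUnit_det _ _ (by rwa [det_transpose]),
    rank_mul_eq_right_of_isUnit_det _ _ h]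

lemma exists_antitone_diagonalization {X : Matrix (Fin m) (Fin m) ℝ} (hX : Xᵀ = X) :
    ∃ U ∈ orthogonalGroup (Fin m) ℝ, ∃ d : Fin m → ℝ, Antitone d ∧ X = U * diagonal d * Uᵀ := by
  have hH : X.IsHermitian := by simpa [IsHermitian] using hX
  set U : Matrix (Fin m) (Fin m) ℝ := (hH.eigenvectorUnitary : Matrix (Fin m) (Fin m) ℝ) with hU
  set d := hH.eigenvalues
  have hUU : Uᵀ * U = 1 := by
    have h := mem_unitaryGroup_iff'.mp hH.eigenvectorUnitary.2
    simpa [star_eq_conjTranspose] using h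
  have hspec : X = U * diagonal d * Uᵀ := by
    have h := hH.spectral_theorem
    simpa [Unitary.conjStarAlgAut_apply, star_eq_conjTranspose, Function.comp_def] using h
  let e := Tuple.sort (fun i => -d i)
  refine ⟨U.submatrix id e, ?_, d ∘ e, ?_, ?_⟩
  · rw [orthogonalGroup, mem_unitaryGroup_iff', star_eq_conjTranspose,
      conjTranspose_eq_transpose_of_trivial, transpose_submatrix, submatrix_mul _ _ _ _ _ Function.bijective_id |>.symm, hUU,
      submatrix_one_equiv]
  · intro i j hij
    have := Tuple.monotone_sort (fun i => -d i) hij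
    simpa using this
  · rw [transpose_submatrix, ← submatrix_diagonal_equiv, submatrix_mul_equiv, submatrix_mul_equiv,
      submatrix_id_id]
    exact hspec

/-! ### Schatten norms in terms of eigenvalues -/

lemma roots_charpoly_conj_diagonal {U : Matrix (Fin m) (Fin m) ℝ}
    (hU : U ∈ orthogonalGroup (Fin m) ℝ) (d : Fin m → ℝ) :
    (U * diagonal d * Uᵀ).charpoly.roots = Finset.univ.val.map d := by
  rw [charpoly_mul_comm, ← Matrix.mul_assoc, orthogonal_transpose_mul hU, Matrix.one_mul,
    charpoly_diagonal, Polynomial.roots_prod _ _ (by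
      simp [Finset.prod_ne_zero_iff, Polynomial.X_sub_C_ne_zero])]
  simp

/-- The characteristic polynomials of `A B` and `B A` differ by a power of the indeterminate, so
their roots differ by zeros only. -/
lemma sum_map_roots_charpoly_mul_comm (A : Matrix (Fin m) (Fin n) ℝ)
    (B : Matrix (Fin n) (Fin m) ℝ) {f : ℝ → ℝ} (hf : f 0 = 0) :
    ((A * B).charpoly.roots.map f).sum = ((B * A).charpoly.roots.map f).sum := by
  have h := congrArg Polynomial.roots (charpoly_mul_comm' A B)
  rw [Polynomial.roots_mul (mul_ne_zero (pow_ne_zero _ Polynomial.X_ne_zero)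
      (charpoly_monic _).ne_zero), Polynomial.roots_mul (mul_ne_zero
      (pow_ne_zero _ Polynomial.X_ne_zero) (charpoly_monic _).ne_zero),
    Polynomial.roots_pow, Polynomial.roots_pow, Polynomial.roots_X] at h
  have h' := congrArg (fun s => (s.map f).sum) h
  simpa [Multiset.map_nsmul, Multiset.sum_nsmul, hf] using h'

lemma matSingularValue_nonneg (M : Matrix (Fin m) (Fin n) ℝ) (i : ℕ) :
    0 ≤ matSingularValue M i :=
  LinearMap.singularValues_nonneg _ _

lemma matSingularValue_antitone (M : Matrix (Fin m) (Fin n) ℝ) :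
    Antitone (matSingularValue M) :=
  LinearMap.singularValues_antitone _

lemma matSingularValue_of_width_le (M : Matrix (Fin m) (Fin n) ℝ) {i : ℕ} (hi : n ≤ i) :
    matSingularValue M i = 0 :=
  LinearMap.singularValues_of_finrank_le _ (by simpa using hi)

lemma matSingularValue_of_height_le (M : Matrix (Fin m) (Fin n) ℝ) {i : ℕ} (hi : m ≤ i) :
    matSingularValue M i = 0 := by
  rw [matSingularValue, LinearMap.singularValues_eq_zero_iff_le_finrank_range]
  refine le_trans (Submodule.finrank_le _) ?_
  simpa using hi

/-- The condition `f 0 = 0` accounts for the zero eigenvalues of `Mᵀ M` beyond the first `min m n`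
places. -/
lemma sum_sq_matSingularValue (M : Matrix (Fin m) (Fin n) ℝ) {f : ℝ → ℝ} (hf : f 0 = 0) :
    ∑ i ∈ Finset.range (min m n), f (matSingularValue M i ^ 2) =
      ((Mᵀ * M).charpoly.roots.map f).sum := by
  have hcp : (LinearMap.adjoint (toEuclideanLin M) ∘ₗ toEuclideanLin M).charpoly =
      (Mᵀ * M).charpoly := by
    have : LinearMap.adjoint (toEuclideanLin M) ∘ₗ toEuclideanLin M = toEuclideanLin (Mᵀ * M) := by
      rw [← toEuclideanLin_conjTranspose_eq_adjoint, conjTranspose_eq_transpose_of_trivial]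
      ext x : 1
      simp [toLpLin_apply, mulVec_mulVec]
    rw [this, toEuclideanLin, toLpLin_eq_toLin, charpoly_toLin]
  have hn : Module.finrank ℝ (EuclideanSpace ℝ (Fin n)) = n := finrank_euclideanSpace_fin
  rw [← hcp, (toEuclideanLin M).isSymmetric_adjoint_comp_self.roots_charpoly_eq_eigenvalues hn,
    Multiset.map_map]
  have h1 : ∑ i ∈ Finset.range (min m n), f (matSingularValue M i ^ 2) =
      ∑ i ∈ Finset.range n, f (matSingularValue M i ^ 2) := by
    refine Finset.sum_subset (by simp) fun i hi hi' => ?_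
    have : m ≤ i := by simp at hi hi'; omega
    simp [matSingularValue_of_height_le M this, hf]
  rw [h1, Finset.sum_range]
  refine Finset.sum_congr rfl fun i _ => ?_
  simp only [Function.comp, matSingularValue, LinearMap.sq_singularValues_fin _ hn]
  rfl

lemma schattenNorm_conj_diagonal {q : ℕ} (hq : 1 ≤ q) {U : Matrix (Fin m) (Fin m) ℝ}
    (hU : U ∈ orthogonalGroup (Fin m) ℝ) (d : Fin m → ℝ) :
    schattenNorm q (U * diagonal d * Uᵀ) = (∑ i, |d i| ^ q) ^ (1 / (q : ℝ)) := by
  have h := sum_sq_matSingularValue (U * diagonal d * Uᵀ) (f := fun x => √x ^ q)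
    (by simp; omega)
  rw [transpose_conj_diagonal, conj_diagonal_mul_conj_diagonal hU,
    roots_charpoly_conj_diagonal hU, Multiset.map_map] at h
  simp only [Real.sqrt_sq (matSingularValue_nonneg _ _), Function.comp_def,
    Real.sqrt_mul_self_eq_abs] at h
  rw [schattenNorm, h]
  rfl

lemma schattenNorm_zero {q : ℕ} (hq : 1 ≤ q) :
    schattenNorm q (0 : Matrix (Fin m) (Fin n) ℝ) = 0 := by
  have hq0 : q ≠ 0 := by omega
  simp [schattenNorm, matSingularValue, hq0]

lemma schattenNorm_neg {q : ℕ} (hq : 1 ≤ q) {X : Matrix (Fin m) (Fin m) ℝ} (hX : Xᵀ = X) :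
    schattenNorm q (-X) = schattenNorm q X := by
  obtain ⟨U, hU, d, -, rfl⟩ := exists_antitone_diagonalization hX
  have : -(U * diagonal d * Uᵀ) = U * diagonal (fun i => -d i) * Uᵀ := by
    rw [← Matrix.neg_mul, ← Matrix.mul_neg, diagonal_neg]
  rw [this, schattenNorm_conj_diagonal hq hU, schattenNorm_conj_diagonal hq hU]
  simp

/-- Squares of even Schatten norms of `M` are Schatten norms of the symmetric matrix `M Mᵀ`. -/
lemma schattenNorm_add_self_sq {q : ℕ} (hq : 1 ≤ q) (M : Matrix (Fin m) (Fin n) ℝ) :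
    schattenNorm (q + q) M ^ 2 = schattenNorm q (M * Mᵀ) := by
  obtain ⟨U, hU, d, -, hd⟩ := exists_antitone_diagonalization (X := M * Mᵀ) (by simp)
  have hd0 : ∀ i, 0 ≤ d i := by
    intro i
    have h1 := congrFun (congrFun (transpose_mul_conj_diagonal_mul hU d) i) i
    have h2 : Uᵀ * (M * Mᵀ) * U = (Uᵀ * M) * (Uᵀ * M)ᵀ := by
      simp [transpose_mul, Matrix.mul_assoc]
    rw [← hd, h2, diagonal_apply_eq, mul_apply] at h1
    rw [← h1]
    exact Finset.sum_nonneg fun j _ => by simpa using mul_self_nonneg _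
  have h := sum_sq_matSingularValue M (f := fun x => x ^ q) (by simp; omega)
  rw [sum_map_roots_charpoly_mul_comm _ _ (by simp; omega), hd,
    roots_charpoly_conj_diagonal hU, Multiset.map_map] at h
  have h' : ∑ i ∈ Finset.range (min m n), matSingularValue M i ^ (q + q) = ∑ i, |d i| ^ q := by
    simp only [abs_of_nonneg (hd0 _)]
    refine Eq.trans (Finset.sum_congr rfl fun i _ => ?_) h
    ring
  rw [hd, schattenNorm_conj_diagonal hq hU, schattenNorm, h', ← Real.rpow_natCast,
    ← Real.rpow_mul (Finset.sum_nonneg fun _ _ => by positivity)]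
  congr 1
  have : (q : ℝ) ≠ 0 := by positivity
  push_cast
  field_simp
  norm_num

/-! ### Pinching and the triangle inequality -/

/-- Jensen's inequality for weights of total mass at most one. -/
lemma abs_sum_weight_mul_pow_le {ι : Type*} (s : Finset ι) {q : ℕ} (hq : 1 ≤ q) (w d : ι → ℝ)
    (hw : ∀ i, 0 ≤ w i) (hw1 : ∑ i ∈ s, w i ≤ 1) :
    |∑ i ∈ s, w i * d i| ^ q ≤ ∑ i ∈ s, w i * |d i| ^ q := by
  have hq' : (1 : ℝ) ≤ q := by exact_mod_cast hq
  have h0 : 0 ≤ ∑ i ∈ s, w i * |d i| ^ q :=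
    Finset.sum_nonneg fun i _ => mul_nonneg (hw i) (by positivity)
  have h1 : |∑ i ∈ s, w i * d i| ≤ ∑ i ∈ s, w i * |d i| := by
    refine (Finset.abs_sum_le_sum_abs _ _).trans (le_of_eq ?_)
    simp [abs_mul, abs_of_nonneg (hw _)]
  have h2 := Real.inner_le_weight_mul_Lp_of_nonneg s hq' w (fun i => |d i|) hw
    (fun i => abs_nonneg _)
  have h3 : (∑ i ∈ s, w i) ^ (1 - (q : ℝ)⁻¹) ≤ 1 :=
    Real.rpow_le_one (Finset.sum_nonneg fun i _ => hw i) hw1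
      (sub_nonneg.mpr (inv_le_one_of_one_le₀ hq'))
  simp only [Real.rpow_natCast] at h2
  have h4 : |∑ i ∈ s, w i * d i| ≤ (∑ i ∈ s, w i * |d i| ^ q) ^ (q : ℝ)⁻¹ :=
    (h1.trans h2).trans (mul_le_of_le_one_left (Real.rpow_nonneg h0 _) h3)
  calc _ ≤ ((∑ i ∈ s, w i * |d i| ^ q) ^ (q : ℝ)⁻¹) ^ q := by gcongr
    _ = _ := Real.rpow_inv_natCast_pow h0 (by omega)

lemma diag_le_one_of_idempotent {E : Matrix (Fin m) (Fin m) ℝ} (h : E * E = E) (ht : Eᵀ = E)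
    (i : Fin m) : E i i ≤ 1 := by
  have h1 : E i i = ∑ j, E i j ^ 2 := by
    conv_lhs => rw [← h, mul_apply]
    refine Finset.sum_congr rfl fun j _ => ?_
    rw [sq]
    congr 1
    exact congrFun (congrFun ht i) j
  have h2 : E i i ^ 2 ≤ ∑ j, E i j ^ 2 :=
    Finset.single_le_sum (f := fun j => E i j ^ 2) (fun j _ => sq_nonneg _) (Finset.mem_univ i)
  nlinarith

/-- Pinching inequality: compressing a symmetric matrix by a projector and reading off the diagonal
in any orthonormal basis does not increase the sum of `q`-th powers. The squared entries of
`Vᵀ Q U` form a doubly substochastic matrix that turns the eigenvalues into the diagonal. -/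
lemma sum_abs_diag_conj_pow_le {q : ℕ} (hq : 1 ≤ q) {U V Q : Matrix (Fin m) (Fin m) ℝ}
    (hU : U ∈ orthogonalGroup (Fin m) ℝ) (hV : V ∈ orthogonalGroup (Fin m) ℝ)
    (hQ : Q * Q = Q) (hQt : Qᵀ = Q) (d : Fin m → ℝ) :
    ∑ i, |(Vᵀ * (Q * (U * diagonal d * Uᵀ) * Q) * V) i i| ^ q ≤ ∑ j, |d j| ^ q := by
  have conj_le : ∀ W ∈ orthogonalGroup (Fin m) ℝ, ∀ i, (Wᵀ * Q * W) i i ≤ 1 := by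
    intro W hW i
    refine diag_le_one_of_idempotent ?_ (by simp [transpose_mul, hQt, Matrix.mul_assoc]) i
    calc _ = Wᵀ * Q * (W * Wᵀ) * Q * W := by simp only [Matrix.mul_assoc]
      _ = Wᵀ * (Q * Q) * W := by
        rw [orthogonal_mul_transpose hW]; simp only [Matrix.mul_assoc, Matrix.one_mul]
      _ = _ := by rw [hQ]
  set C := Vᵀ * Q * U with hC
  have hCt : Cᵀ = Uᵀ * Q * V := by simp [hC, transpose_mul, hQt, Matrix.mul_assoc]
  have hrow : ∀ i, ∑ j, C i j ^ 2 ≤ 1 := by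
    intro i
    have h : C * Cᵀ = Vᵀ * Q * V := by
      calc C * Cᵀ = Vᵀ * Q * (U * Uᵀ) * Q * V := by rw [hCt, hC]; simp only [Matrix.mul_assoc]
        _ = Vᵀ * (Q * Q) * V := by
          rw [orthogonal_mul_transpose hU]; simp only [Matrix.mul_assoc, Matrix.one_mul]
        _ = _ := by rw [hQ]
    have h' := conj_le V hV i
    rw [← h, mul_apply] at h'
    simpa [sq] using h'
  have hcol : ∀ j, ∑ i, C i j ^ 2 ≤ 1 := by
    intro j
    have h : Cᵀ * C = Uᵀ * Q * U := by
      calc Cᵀ * C = Uᵀ * Q * (V * Vᵀ) * Q * U := by rw [hCt, hC]; simp only [Matrix.mul_assoc]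
        _ = Uᵀ * (Q * Q) * U := by
          rw [orthogonal_mul_transpose hV]; simp only [Matrix.mul_assoc, Matrix.one_mul]
        _ = _ := by rw [hQ]
    have h' := conj_le U hU j
    rw [← h, mul_apply] at h'
    simpa [sq] using h'
  have hdiag : ∀ i, (Vᵀ * (Q * (U * diagonal d * Uᵀ) * Q) * V) i i = ∑ j, C i j ^ 2 * d j := by
    intro i
    have h : Vᵀ * (Q * (U * diagonal d * Uᵀ) * Q) * V = C * diagonal d * Cᵀ := by
      rw [hCt, hC]; simp only [Matrix.mul_assoc]
    rw [h, mul_apply]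
    refine Finset.sum_congr rfl fun j _ => ?_
    rw [mul_diagonal, transpose_apply]
    ring
  calc _ ≤ ∑ i, ∑ j, C i j ^ 2 * |d j| ^ q := by
        refine Finset.sum_le_sum fun i _ => ?_
        rw [hdiag]
        exact abs_sum_weight_mul_pow_le _ hq _ _ (fun j => sq_nonneg _) (hrow i)
    _ = ∑ j, (∑ i, C i j ^ 2) * |d j| ^ q := by
        rw [Finset.sum_comm]
        simp only [Finset.sum_mul]
    _ ≤ _ := Finset.sum_le_sum fun j _ => mul_le_of_le_one_left (by positivity) (hcol j)

lemma schattenNorm_projector_conj_le {q : ℕ} (hq : 1 ≤ q) {X Q : Matrix (Fin m) (Fin m) ℝ}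
    (hX : Xᵀ = X) (hQ : Q * Q = Q) (hQt : Qᵀ = Q) :
    schattenNorm q (Q * X * Q) ≤ schattenNorm q X := by
  obtain ⟨V, hV, l, -, hl⟩ := exists_antitone_diagonalization (X := Q * X * Q)
    (by simp [transpose_mul, hX, hQt, Matrix.mul_assoc])
  obtain ⟨U, hU, d, -, rfl⟩ := exists_antitone_diagonalization hX
  have h := sum_abs_diag_conj_pow_le hq hU hV hQ hQt d
  rw [hl, transpose_mul_conj_diagonal_mul hV] at h
  simp only [diagonal_apply_eq] at h
  rw [hl, schattenNorm_conj_diagonal hq hV, schattenNorm_conj_diagonal hq hU]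
  gcongr

/-- The triangle inequality: in an eigenbasis of `X + Y` it is Minkowski's inequality for the
diagonals of `X` and `Y`, which the pinching inequality controls. -/
lemma schattenNorm_add_le {q : ℕ} (hq : 1 ≤ q) {X Y : Matrix (Fin m) (Fin m) ℝ}
    (hX : Xᵀ = X) (hY : Yᵀ = Y) :
    schattenNorm q (X + Y) ≤ schattenNorm q X + schattenNorm q Y := by
  obtain ⟨V, hV, l, -, hl⟩ := exists_antitone_diagonalization (X := X + Y) (by simp [hX, hY])
  have key : ∀ Z : Matrix (Fin m) (Fin m) ℝ, Zᵀ = Z →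
      (∑ i, |(Vᵀ * Z * V) i i| ^ q) ^ (1 / (q : ℝ)) ≤ schattenNorm q Z := by
    intro Z hZ
    obtain ⟨U, hU, d, -, rfl⟩ := exists_antitone_diagonalization hZ
    have h := sum_abs_diag_conj_pow_le hq hU hV (Matrix.one_mul 1) transpose_one d
    rw [Matrix.one_mul, Matrix.mul_one] at h
    rw [schattenNorm_conj_diagonal hq hU]
    gcongr
  have hli : ∀ i, l i = (Vᵀ * X * V) i i + (Vᵀ * Y * V) i i := by
    intro i
    have h := congrFun (congrFun (transpose_mul_conj_diagonal_mul hV l) i) i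
    rw [← hl, Matrix.mul_add, Matrix.add_mul, diagonal_apply_eq] at h
    exact h.symm
  have hM := Real.Lp_add_le Finset.univ (fun i => (Vᵀ * X * V) i i) (fun i => (Vᵀ * Y * V) i i)
    (p := q) (by exact_mod_cast hq)
  simp only [Real.rpow_natCast, ← hli] at hM
  rw [hl, schattenNorm_conj_diagonal hq hV]
  exact hM.trans (add_le_add (key X hX) (key Y hY))

lemma abs_schattenNorm_sub_le {q : ℕ} (hq : 1 ≤ q) {X Y : Matrix (Fin m) (Fin m) ℝ}
    (hX : Xᵀ = X) (hY : Yᵀ = Y) :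
    |schattenNorm q X - schattenNorm q Y| ≤ schattenNorm q (X - Y) := by
  have h1 := schattenNorm_add_le hq (X := X - Y) (Y := Y) (by simp [hX, hY]) hY
  have h2 := schattenNorm_add_le hq (X := Y - X) (Y := X) (by simp [hX, hY]) hX
  rw [← neg_sub X Y, schattenNorm_neg hq (by simp [hX, hY]), neg_sub, sub_add_cancel] at h2
  rw [sub_add_cancel] at h1
  rw [abs_le]
  constructor <;> linarith

/-- By the Cauchy–Schwarz inequality over the nonzero eigenvalues. -/
lemma schattenNorm_le_rank_rpow_mul {q : ℕ} (hq : 1 ≤ q) {X : Matrix (Fin m) (Fin m) ℝ}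
    (hX : Xᵀ = X) {r : ℝ} (hr : (X.rank : ℝ) ≤ r) :
    schattenNorm q X ≤ r ^ (1 / ((q + q : ℕ) : ℝ)) * schattenNorm (q + q) X := by
  obtain ⟨U, hU, d, -, rfl⟩ := exists_antitone_diagonalization hX
  rw [rank_conj_diagonal hU, rank_diagonal, Fintype.card_subtype] at hr
  have hr0 : 0 ≤ r := le_trans (Nat.cast_nonneg _) hr
  have h1 : (∑ i, |d i| ^ q) ^ 2 ≤ r * ∑ i, |d i| ^ (q + q) := by
    have h2 : ∑ i, |d i| ^ q = ∑ i ∈ Finset.univ.filter (fun i => d i ≠ 0), |d i| ^ q := by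
      have hq0 : q ≠ 0 := by omega
      rw [Finset.sum_filter]
      refine Finset.sum_congr rfl fun i _ => ?_
      split_ifs with hi
      · rfl
      · simp [not_not.mp hi, hq0]
    rw [h2]
    refine sq_sum_le_card_mul_sum_sq.trans ?_
    refine mul_le_mul hr ?_ (Finset.sum_nonneg fun i _ => by positivity) hr0
    refine (Finset.sum_le_sum_of_subset_of_nonneg (Finset.subset_univ _)
      fun i _ _ => by positivity).trans (le_of_eq ?_)
    exact Finset.sum_congr rfl fun i _ => by ring
  have h0 : 0 ≤ ∑ i, |d i| ^ q := Finset.sum_nonneg fun i _ => by positivity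
  have h0' : 0 ≤ ∑ i, |d i| ^ (q + q) := Finset.sum_nonneg fun i _ => by positivity
  rw [schattenNorm_conj_diagonal hq hU, schattenNorm_conj_diagonal (by omega) hU,
    ← Real.mul_rpow hr0 h0']
  have h3 : (∑ i, |d i| ^ q) ^ (1 / (q : ℝ)) =
      ((∑ i, |d i| ^ q) ^ 2) ^ (1 / ((q + q : ℕ) : ℝ)) := by
    rw [← Real.rpow_natCast _ 2, ← Real.rpow_mul h0]
    congr 1
    have : (q : ℝ) ≠ 0 := by positivity
    push_cast
    field_simp
    norm_num
  rw [h3]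
  gcongr

/-! ### Projection errors -/

lemma one_sub_mul_self {P : Matrix (Fin m) (Fin m) ℝ} (hP : P * P = P) :
    (1 - P) * (1 - P) = 1 - P :=
  (show IsIdempotentElem P from hP).one_sub

lemma schattenNorm_one_sub_mul_sq {q : ℕ} (hq : 1 ≤ q) {P : Matrix (Fin m) (Fin m) ℝ}
    (hPt : Pᵀ = P) (A : Matrix (Fin m) (Fin n) ℝ) :
    schattenNorm (q + q) ((1 - P) * A) ^ 2 = schattenNorm q ((1 - P) * (A * Aᵀ) * (1 - P)) := by
  rw [schattenNorm_add_self_sq hq]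
  simp [transpose_mul, hPt, Matrix.mul_assoc]

lemma abs_schattenNorm_one_sub_mul_sq_sub_le {c q : ℕ} (hq : 1 ≤ q)
    {P : Matrix (Fin m) (Fin m) ℝ} (hP : P * P = P) (hPt : Pᵀ = P)
    (A : Matrix (Fin m) (Fin n) ℝ) (At : Matrix (Fin m) (Fin c) ℝ) :
    |schattenNorm (q + q) ((1 - P) * A) ^ 2 - schattenNorm (q + q) ((1 - P) * At) ^ 2| ≤
      min (schattenNorm q (A * Aᵀ - At * Atᵀ))
        (((m : ℝ) - (P.rank : ℝ)) ^ (1 / ((q + q : ℕ) : ℝ)) *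
          schattenNorm (q + q) (A * Aᵀ - At * Atᵀ)) := by
  have hQ := one_sub_mul_self hP
  have hQt : (1 - P)ᵀ = 1 - P := by simp [hPt]
  have hD : (A * Aᵀ - At * Atᵀ)ᵀ = A * Aᵀ - At * Atᵀ := by simp
  have hsymm : ∀ Z : Matrix (Fin m) (Fin m) ℝ, Zᵀ = Z →
      ((1 - P) * Z * (1 - P))ᵀ = (1 - P) * Z * (1 - P) := fun Z hZ => by
    rw [transpose_mul, transpose_mul, hQt, hZ, Matrix.mul_assoc]
  rw [schattenNorm_one_sub_mul_sq hq hPt, schattenNorm_one_sub_mul_sq hq hPt]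
  have h1 := abs_schattenNorm_sub_le hq (hsymm (A * Aᵀ) (by simp)) (hsymm (At * Atᵀ) (by simp))
  rw [← Matrix.sub_mul, ← Matrix.mul_sub] at h1
  have hrank : (((1 - P) * (A * Aᵀ - At * Atᵀ) * (1 - P)).rank : ℝ) ≤ (m : ℝ) - (P.rank : ℝ) := by
    have h2 : P.rank + (1 - P).rank ≤ m := by
      simpa using rank_add_rank_le_card_of_mul_eq_zero (A := P) (B := 1 - P)
        (by rw [Matrix.mul_sub, hP, Matrix.mul_one, sub_self])
    have h3 := rank_mul_le_right ((1 - P) * (A * Aᵀ - At * Atᵀ)) (1 - P)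
    rw [le_sub_iff_add_le]
    exact_mod_cast (by omega)
  refine le_min (h1.trans (schattenNorm_projector_conj_le hq hD hQ hQt))
    (h1.trans ((schattenNorm_le_rank_rpow_mul hq (hsymm _ hD) hrank).trans ?_))
  have h0 : (0 : ℝ) ≤ (m : ℝ) - (P.rank : ℝ) := le_trans (Nat.cast_nonneg _) hrank
  gcongr
  exact schattenNorm_projector_conj_le (by omega) hD hQ hQt

/-! ### Weyl's inequality for compressions and the optimality of truncation -/

lemma dotProduct_conj_diagonal_mulVec (U : Matrix (Fin m) (Fin m) ℝ) (d x : Fin m → ℝ) :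
    x ⬝ᵥ ((U * diagonal d * Uᵀ) *ᵥ x) = ∑ i, d i * (Uᵀ *ᵥ x) i ^ 2 := by
  rw [← mulVec_mulVec, ← mulVec_mulVec, dotProduct_mulVec, ← mulVec_transpose, dotProduct]
  refine Finset.sum_congr rfl fun i _ => ?_
  rw [mulVec_diagonal]
  ring

lemma sum_sq_transpose_mulVec {U : Matrix (Fin m) (Fin m) ℝ}
    (hU : U ∈ orthogonalGroup (Fin m) ℝ) (x : Fin m → ℝ) :
    ∑ i, (Uᵀ *ᵥ x) i ^ 2 = x ⬝ᵥ x := by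
  have h := dotProduct_conj_diagonal_mulVec U (fun _ => 1) x
  rw [diagonal_one, Matrix.mul_one, orthogonal_mul_transpose hU, one_mulVec] at h
  simpa using h.symm

/-- Compressing to a subspace of codimension at most `k` shifts eigenvalues by at most `k` places.
A dimension count gives a nonzero vector in the range of the compression on which the quadratic form
is at least `b (j + k)` and at most `l j` times the squared norm. -/
lemma le_eigenvalue_projector_conj {k : ℕ} {U V P : Matrix (Fin m) (Fin m) ℝ}
    (hU : U ∈ orthogonalGroup (Fin m) ℝ) (hV : V ∈ orthogonalGroup (Fin m) ℝ)
    (hPt : Pᵀ = P) (hk : P.rank ≤ k) {b l : Fin m → ℝ}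
    (hb : Antitone b) (hl : Antitone l)
    (h : (1 - P) * (U * diagonal b * Uᵀ) * (1 - P) = V * diagonal l * Vᵀ)
    {i j : Fin m} (hij : (i : ℕ) = j + k) : b i ≤ l j := by
  -- A vector in the kernel of `F` is fixed by `1 - P`, and has no component along the columns of `U`
  -- after the `i`th nor along those of `V` before the `j`th: `k + (m - 1 - i) + j < m` conditions.
  let F : (Fin m → ℝ) →ₗ[ℝ] P.mulVecLin.range × ({a : Fin m // i < a} → ℝ) ×
      ({a : Fin m // a < j} → ℝ) :=
    P.mulVecLin.rangeRestrict.prod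
      ((LinearMap.pi fun a => LinearMap.proj a.1 ∘ₗ Uᵀ.mulVecLin).prod
        (LinearMap.pi fun a => LinearMap.proj a.1 ∘ₗ Vᵀ.mulVecLin))
  have hdim : Module.finrank ℝ (P.mulVecLin.range × ({a : Fin m // i < a} → ℝ) ×
      ({a : Fin m // a < j} → ℝ)) < Module.finrank ℝ (Fin m → ℝ) := by
    have h1 : Module.finrank ℝ P.mulVecLin.range ≤ k := hk
    have h2 : Fintype.card {a : Fin m // i < a} = m - 1 - i := by
      rw [Fintype.card_subtype, ← Fin.card_Ioi]
      congr 1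
      ext; simp
    have h3 : Fintype.card {a : Fin m // a < j} = j := by
      rw [Fintype.card_subtype, ← Fin.card_Iio]
      congr 1
      ext; simp
    simp only [Module.finrank_prod, Module.finrank_fintype_fun_eq_card, h2, h3, Fintype.card_fin]
    have := i.2
    omega
  obtain ⟨x, hxF, hx0⟩ :=
    (Submodule.ne_bot_iff _).mp (LinearMap.ker_ne_bot_of_finrank_lt (f := F) hdim)
  rw [LinearMap.mem_ker] at hxF
  have hPx : P *ᵥ x = 0 := congrArg Subtype.val (congrArg Prod.fst hxF)
  have hUx : ∀ a, i < a → (Uᵀ *ᵥ x) a = 0 := fun a ha =>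
    congrFun (congrArg (fun y => y.2.1) hxF) ⟨a, ha⟩
  have hVx : ∀ a, a < j → (Vᵀ *ᵥ x) a = 0 := fun a ha =>
    congrFun (congrArg (fun y => y.2.2) hxF) ⟨a, ha⟩
  have hQx : (1 - P) *ᵥ x = x := by rw [sub_mulVec, hPx, one_mulVec, sub_zero]
  have hxQ : x ᵥ* (1 - P) = x := by
    rw [← mulVec_transpose, transpose_sub, hPt, transpose_one, hQx]
  have hcompress : ∀ X : Matrix (Fin m) (Fin m) ℝ,
      x ⬝ᵥ (((1 - P) * X * (1 - P)) *ᵥ x) = x ⬝ᵥ (X *ᵥ x) := fun X => by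
    rw [← mulVec_mulVec, hQx, ← mulVec_mulVec, dotProduct_mulVec, hxQ]
  have hform : ∑ a, b a * (Uᵀ *ᵥ x) a ^ 2 = ∑ a, l a * (Vᵀ *ᵥ x) a ^ 2 := by
    rw [← dotProduct_conj_diagonal_mulVec, ← dotProduct_conj_diagonal_mulVec, ← h, hcompress]
  have hlow : b i * (x ⬝ᵥ x) ≤ ∑ a, b a * (Uᵀ *ᵥ x) a ^ 2 := by
    rw [← sum_sq_transpose_mulVec hU, Finset.mul_sum]
    refine Finset.sum_le_sum fun a _ => ?_
    rcases lt_or_ge i a with ha | ha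
    · simp [hUx a ha]
    · exact mul_le_mul_of_nonneg_right (hb ha) (sq_nonneg _)
  have hupp : ∑ a, l a * (Vᵀ *ᵥ x) a ^ 2 ≤ l j * (x ⬝ᵥ x) := by
    rw [← sum_sq_transpose_mulVec hV, Finset.mul_sum]
    refine Finset.sum_le_sum fun a _ => ?_
    rcases lt_or_ge a j with ha | ha
    · simp [hVx a ha]
    · exact mul_le_mul_of_nonneg_right (hl ha) (sq_nonneg _)
  have hpos : 0 < x ⬝ᵥ x :=
    lt_of_le_of_ne (Finset.sum_nonneg fun a _ => mul_self_nonneg _)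
      (fun h => hx0 (dotProduct_self_eq_zero.mp h.symm))
  exact le_of_mul_le_mul_right (hlow.trans (hform ▸ hupp)) hpos

/-- Among compressions to a subspace of codimension at most `k`, discarding the `k` largest
eigenvalues gives the least norm. -/
lemma schattenNorm_tail_le_projector_conj {q k : ℕ} (hq : 1 ≤ q)
    {U P : Matrix (Fin m) (Fin m) ℝ} (hU : U ∈ orthogonalGroup (Fin m) ℝ)
    (hPt : Pᵀ = P) (hk : P.rank ≤ k) {b : Fin m → ℝ} (hb : Antitone b) (hb0 : ∀ i, 0 ≤ b i) :
    schattenNorm q (U * diagonal (fun i : Fin m => if (i : ℕ) < k then 0 else b i) * Uᵀ) ≤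
      schattenNorm q ((1 - P) * (U * diagonal b * Uᵀ) * (1 - P)) := by
  obtain ⟨V, hV, l, hl, h⟩ := exists_antitone_diagonalization
    (X := (1 - P) * (U * diagonal b * Uᵀ) * (1 - P))
    (by simp [transpose_mul, hPt, Matrix.mul_assoc])
  rw [h, schattenNorm_conj_diagonal hq hU, schattenNorm_conj_diagonal hq hV]
  have hq0 : q ≠ 0 := by omega
  have hsum : ∑ i : Fin m, |if (i : ℕ) < k then 0 else b i| ^ q =
      ∑ i ∈ Finset.univ.filter (fun i : Fin m => k ≤ (i : ℕ)), b i ^ q := by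
    rw [Finset.sum_filter]
    refine Finset.sum_congr rfl fun i _ => ?_
    rcases lt_or_ge (i : ℕ) k with hi | hi
    · simp [hi, not_le.mpr hi, hq0]
    · simp [hi, not_lt.mpr hi, abs_of_nonneg (hb0 i)]
  rw [hsum]
  refine Real.rpow_le_rpow (Finset.sum_nonneg fun i _ => pow_nonneg (hb0 i) _) ?_ (by positivity)
  -- The shift `i ↦ i - k` is injective on the indices `i ≥ k`.
  let g : Fin m → Fin m := fun i => ⟨i - k, lt_of_le_of_lt (Nat.sub_le _ _) i.2⟩
  calc _ ≤ ∑ i ∈ Finset.univ.filter (fun i : Fin m => k ≤ (i : ℕ)), |l (g i)| ^ q := by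
        refine Finset.sum_le_sum fun i hi => ?_
        have hi' : k ≤ (i : ℕ) := by simpa using hi
        have := le_eigenvalue_projector_conj hU hV hPt hk hb hl h (i := i) (j := g i)
          (by simp only [g]; omega)
        exact pow_le_pow_left₀ (hb0 i) (this.trans (le_abs_self _)) _
    _ = ∑ j ∈ (Finset.univ.filter (fun i : Fin m => k ≤ (i : ℕ))).image g, |l j| ^ q := by
        refine (Finset.sum_image (f := fun j => |l j| ^ q) fun x hx y hy hxy => ?_).symm
        simp only [Finset.coe_filter, Finset.mem_univ, true_and, Set.mem_ofPred_eq] at hx hy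
        simp only [g, Fin.mk.injEq] at hxy
        ext
        omega
    _ ≤ _ := Finset.sum_le_sum_of_subset_of_nonneg (Finset.subset_univ _)
        fun _ _ _ => by positivity

/-! ### Truncated singular value decompositions -/

/-- The entries of `t` from place `n` on do not appear in `rectDiag m n t`, but do appear on the
right-hand side when `n < m`; hence they are required to vanish. -/
lemma rectDiag_mul_transpose {s t : ℕ → ℝ} (ht : ∀ i, n ≤ i → t i = 0) :
    rectDiag m n s * (rectDiag m n t)ᵀ = diagonal fun i : Fin m => s i * t i := by
  ext i j
  rw [mul_apply, diagonal_apply]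
  simp only [rectDiag, transpose_apply, of_apply]
  by_cases hi : (i : ℕ) < n
  · rw [Finset.sum_eq_single ⟨i, hi⟩]
    · by_cases hij : i = j
      · simp [hij]
      · have hji : (j : ℕ) ≠ i := fun h => hij (Fin.ext h.symm)
        simp [hij, hji]
    · intro a _ ha
      have : (i : ℕ) ≠ a := fun h => ha (Fin.ext h.symm)
      simp [this]
    · simp
  · rw [Finset.sum_eq_zero, ht i (not_lt.mp hi), mul_zero, ite_self]
    intro a _
    have : (i : ℕ) ≠ a := by have := a.2; omega
    simp [this]

lemma svd_mul_transpose {U : Matrix (Fin m) (Fin m) ℝ} {V : Matrix (Fin n) (Fin n) ℝ}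
    (hV : V ∈ orthogonalGroup (Fin n) ℝ) {s t : ℕ → ℝ} (ht : ∀ i, n ≤ i → t i = 0) :
    (U * rectDiag m n s * Vᵀ) * (U * rectDiag m n t * Vᵀ)ᵀ =
      U * diagonal (fun i : Fin m => s i * t i) * Uᵀ := by
  calc _ = U * (rectDiag m n s * (Vᵀ * V) * (rectDiag m n t)ᵀ) * Uᵀ := by
        simp only [transpose_mul, transpose_transpose, Matrix.mul_assoc]
    _ = _ := by rw [orthogonal_transpose_mul hV, Matrix.mul_one, rectDiag_mul_transpose ht]

lemma svd_sub (U : Matrix (Fin m) (Fin m) ℝ) (V : Matrix (Fin n) (Fin n) ℝ) (s : ℕ → ℝ) (k : ℕ) :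
    U * rectDiag m n s * Vᵀ - U * rectDiag m n (fun i => if i < k then s i else 0) * Vᵀ =
      U * rectDiag m n (fun i => if i < k then 0 else s i) * Vᵀ := by
  rw [← Matrix.sub_mul, ← Matrix.mul_sub]
  congr 2
  ext i j
  rw [Matrix.sub_apply]
  simp only [rectDiag, of_apply]
  split_ifs <;> simp

lemma IsBestRankApprox.exists_diagonalization {k : ℕ} {A B : Matrix (Fin m) (Fin n) ℝ}
    (h : IsBestRankApprox k A B) :
    ∃ U ∈ orthogonalGroup (Fin m) ℝ,
      A * Aᵀ = U * diagonal (fun i : Fin m => matSingularValue A i ^ 2) * Uᵀ ∧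
      (A - B) * (A - B)ᵀ =
        U * diagonal (fun i : Fin m => if (i : ℕ) < k then 0 else matSingularValue A i ^ 2) *
          Uᵀ := by
  obtain ⟨U, V, hU, hV, hA, hB⟩ := h
  refine ⟨U, hU, ?_, ?_⟩
  · conv_lhs => rw [hA]
    rw [svd_mul_transpose hV fun i hi => matSingularValue_of_width_le A hi]
    simp only [sq]
  · have hAB : A - B =
        U * rectDiag m n (fun i => if i < k then 0 else matSingularValue A i) * Vᵀ := by
      conv_lhs => rw [hA, hB]
      exact svd_sub U V _ k
    rw [hAB, svd_mul_transpose hV fun i hi => by simp [matSingularValue_of_width_le A hi]]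
    congr 3
    ext i
    split_ifs <;> ring

/-- The projector onto the leading `k` left singular vectors leaves exactly the truncation
error. -/
lemma IsBestRankApprox.exists_projector {k q : ℕ} (hq : 1 ≤ q) (hkm : k ≤ m)
    {A B : Matrix (Fin m) (Fin n) ℝ} (h : IsBestRankApprox k A B) :
    ∃ P : Matrix (Fin m) (Fin m) ℝ, P * P = P ∧ Pᵀ = P ∧ P.rank = k ∧
      schattenNorm (q + q) ((1 - P) * A) ^ 2 = schattenNorm (q + q) (A - B) ^ 2 := by
  obtain ⟨U, hU, hA, hAB⟩ := h.exists_diagonalization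
  set w : Fin m → ℝ := fun i => if (i : ℕ) < k then 1 else 0 with hw
  have hPt := transpose_conj_diagonal U w
  have hone : 1 - U * diagonal w * Uᵀ = U * diagonal (fun i => 1 - w i) * Uᵀ := by
    rw [← diagonal_sub, diagonal_one, Matrix.mul_sub, Matrix.sub_mul, Matrix.mul_one,
      orthogonal_mul_transpose hU]
  refine ⟨U * diagonal w * Uᵀ, ?_, hPt, ?_, ?_⟩
  · rw [conj_diagonal_mul_conj_diagonal hU]
    congr 3
    ext i
    simp [hw]
  · rw [rank_conj_diagonal hU, rank_diagonal, Fintype.card_subtype]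
    have hset : (Finset.univ.filter fun i : Fin m => w i ≠ 0) =
        Finset.univ.filter fun i : Fin m => (i : ℕ) < k := by
      ext i
      simp [hw]
    rw [hset, Fin.card_filter_val_lt]
    omega
  · rw [schattenNorm_one_sub_mul_sq hq hPt, schattenNorm_add_self_sq hq, hAB, hone, hA,
      conj_diagonal_mul_conj_diagonal hU, conj_diagonal_mul_conj_diagonal hU]
    congr 4
    ext i
    simp only [hw]
    split_ifs <;> ring

lemma IsBestRankApprox.schattenNorm_sub_sq_le {k q : ℕ} (hq : 1 ≤ q)
    {A B : Matrix (Fin m) (Fin n) ℝ} (h : IsBestRankApprox k A B)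
    {P : Matrix (Fin m) (Fin m) ℝ} (hPt : Pᵀ = P) (hk : P.rank ≤ k) :
    schattenNorm (q + q) (A - B) ^ 2 ≤ schattenNorm (q + q) ((1 - P) * A) ^ 2 := by
  obtain ⟨U, hU, hA, hAB⟩ := h.exists_diagonalization
  rw [schattenNorm_one_sub_mul_sq hq hPt, schattenNorm_add_self_sq hq, hAB, hA]
  refine schattenNorm_tail_le_projector_conj hq hU hPt hk (fun i j hij => ?_)
    (fun i => sq_nonneg _)
  exact pow_le_pow_left₀ (matSingularValue_nonneg _ _) (matSingularValue_antitone A hij) 2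

/-! ### The projector onto the column space -/

lemma mul_pinv_idempotent (A : Matrix (Fin m) (Fin n) ℝ) :
    (A * pinv A) * (A * pinv A) = A * pinv A := by
  rw [← Matrix.mul_assoc, (pinv_spec A).mul_mul_self]

lemma one_sub_mul_pinv_mul_self (A : Matrix (Fin m) (Fin n) ℝ) : (1 - A * pinv A) * A = 0 := by
  rw [Matrix.sub_mul, Matrix.one_mul, (pinv_spec A).mul_mul_self, sub_self]

lemma rank_mul_pinv (A : Matrix (Fin m) (Fin n) ℝ) : (A * pinv A).rank = A.rank := by
  refine le_antisymm (rank_mul_le_left _ _) ?_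
  have h := rank_mul_le_left (A * pinv A) A
  rwa [(pinv_spec A).mul_mul_self] at h

/-- Holds for every `B`: the complementary projector annihilates `B`, so `A` may be replaced by
`A - B`, whose norm the projector does not increase. -/
lemma schattenNorm_one_sub_mul_pinv_mul_sq_le {q : ℕ} (hq : 1 ≤ q)
    (A B : Matrix (Fin m) (Fin n) ℝ) :
    schattenNorm (q + q) ((1 - B * pinv B) * A) ^ 2 ≤ schattenNorm (q + q) (A - B) ^ 2 := by
  have hPt := (pinv_spec B).left_symm
  have h : (1 - B * pinv B) * A = (1 - B * pinv B) * (A - B) := by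
    rw [Matrix.mul_sub, one_sub_mul_pinv_mul_self, sub_zero]
  rw [h, schattenNorm_one_sub_mul_sq hq hPt, schattenNorm_add_self_sq hq]
  exact schattenNorm_projector_conj_le hq (by simp) (one_sub_mul_self (mul_pinv_idempotent B))
    (by rw [transpose_sub, transpose_one, hPt])

end SchattenNorms

/-! ### Projection and low-rank approximation bounds -/

theorem mainTheorem7 {m n c : ℕ} (p : ℕ) (hp : 1 ≤ p) (hpe : Even p)
    (A : Matrix (Fin m) (Fin n) ℝ) (At : Matrix (Fin m) (Fin c) ℝ) :
    (∀ P : Matrix (Fin m) (Fin m) ℝ, P * P = P → P.transpose = P →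
      |schattenNorm p ((1 - P) * A) ^ 2 - schattenNorm p ((1 - P) * At) ^ 2| ≤
        min (schattenNorm (p / 2) (A * A.transpose - At * At.transpose))
          (((m : ℝ) - (P.rank : ℝ)) ^ (1 / (p : ℝ)) *
            schattenNorm p (A * A.transpose - At * At.transpose))) ∧
    (At.rank = c →
      schattenNorm p ((1 - At * pinv At) * A) ^ 2 ≤
        min (schattenNorm (p / 2) (A * A.transpose - At * At.transpose))
          (((m : ℝ) - (c : ℝ)) ^ (1 / (p : ℝ)) *
            schattenNorm p (A * A.transpose - At * At.transpose))) ∧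
    (∀ (k : ℕ) (Ak : Matrix (Fin m) (Fin n) ℝ) (Atk : Matrix (Fin m) (Fin c) ℝ),
      IsBestRankApprox k A Ak → IsBestRankApprox k At Atk → Atk.rank = k →
      schattenNorm p ((1 - Atk * pinv Atk) * A) ^ 2 ≤
        schattenNorm p (A - Ak) ^ 2 +
          2 * min (schattenNorm (p / 2) (A * A.transpose - At * At.transpose))
            (((m : ℝ) - (k : ℝ)) ^ (1 / (p : ℝ)) *
              schattenNorm p (A * A.transpose - At * At.transpose))) := by
  obtain ⟨q, rfl⟩ := hpe
  have hq : 1 ≤ q := by omega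
  have hdiv : (q + q) / 2 = q := by omega
  rw [hdiv]
  have h1 := fun (P : Matrix (Fin m) (Fin m) ℝ) (hP : P * P = P) (hPt : P.transpose = P) =>
    abs_schattenNorm_one_sub_mul_sq_sub_le hq hP hPt A At
  refine ⟨h1, fun hc => ?_, fun k Ak Atk hAk hAtk hrank => ?_⟩
  · have h := h1 _ (mul_pinv_idempotent At) (pinv_spec At).left_symm
    rw [one_sub_mul_pinv_mul_self, schattenNorm_zero (by omega), rank_mul_pinv, hc] at h
    simpa using h
  · have hkm : k ≤ m := hrank ▸ Matrix.rank_le_height Atk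
    obtain ⟨P, hP, hPt, hPk, hPA⟩ := hAk.exists_projector hq hkm
    have hA := h1 _ (mul_pinv_idempotent Atk) (pinv_spec Atk).left_symm
    have hAt := h1 P hP hPt
    rw [rank_mul_pinv, hrank] at hA
    rw [hPk, hPA] at hAt
    have hproj := schattenNorm_one_sub_mul_pinv_mul_sq_le hq At Atk
    have hbest := hAtk.schattenNorm_sub_sq_le hq hPt hPk.le
    have hA' := (abs_le.mp hA).2
    have hAt' := (abs_le.mp hAt).1
    linarith
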